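/- Let $BM_{00}$ be the law on $C([0,1])$ (with its Borel $\sigma$-algebra) of the standard Brownian bridge of length one, i.e. of the continuous centered Gaussian process with covariance $\min(s,t)-st$, and let circular Brownian motion be the infinite measure $$CBM(\mathcal A)=\frac1{\sqrt{2\pi}}\int_{-\infty}^{\infty} BM_{00}\bigl(\{p : p+c\in\mathcal A\}\bigr)\,dc$$ on $C([0,1])$. Let $\phi:[0,1]\to\mathbb R$ be continuous with $\int_0^1\phi=0$. Then there is exactly one probability measure $\tilde P$, the $CBM$ conditioned on both $\int_0^1 p=0$ and $\int_0^1\phi p=0$, which is the weak limit, as $\varepsilon\downarrow0$ and $h\downarrow0$, of the conditional probabilities $$CBM\Bigl(\,\cdot\;\Big|\;\Bigl|\int_0^1 p\Bigr|\le\varepsilon,\ \Bigl|\int_0^1\phi p\Bigr|\le h\Bigr).$$ Denote its expectation by $\tilde E$. Let $\varphi:\mathbb R\to\mathbb R$ be twice continuously differentiable with $\varphi(0)=\varphi(1)$ and $\varphi'(0)=\varphi'(1)$ (for instance, $C^2$ and of period one), and suppose $\int_0^1\varphi=0$ and $\int_0^1\phi\varphi=0$. Then, for every bounded measurable $F:C([0,1])\to\mathbb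 R$, the right-hand side below is the expectation of an integrable function and $$\tilde E\bigl[F(p)\bigr]=\tilde E\left[F(p+\varphi)\exp\left\{\int_0^1\varphi''p-\frac12\int_0^1|\varphi'|^2\right\}\right].$$ -/

import Mathlib

open MeasureTheory ProbabilityTheory Filter Topology
open scoped BoundedContinuousFunction

noncomputable section

namespace CircularBM

/-- The path space: continuous real functions `p(x)`, `0 ≤ x ≤ 1`, with the supremum norm. -/
abbrev Path : Type := C(unitInterval, ℝ)

/-- Path space carries its Borel σ-algebra. -/
instance instMeasurableSpacePath : MeasurableSpace Path := borel Path

instance instBorelSpacePath : BorelSpace Path := ⟨rfl⟩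

/-- `B` is the law on path space of the standard Brownian Bridge of length one (from `0` to `0`):
under `B` the coordinate process is Gaussian, centered, with covariance `min s t - s t`. -/
structure IsBrownianBridgeLaw (B : Measure Path) : Prop where
  isGaussianProcess : IsGaussianProcess (fun (t : unitInterval) (p : Path) => p t) B
  mean_eq_zero : ∀ t : unitInterval, ∫ p : Path, p t ∂B = 0
  covariance_eq : ∀ s t : unitInterval,
    cov[fun p : Path => p s, fun p : Path => p t; B] = min (s : ℝ) (t : ℝ) - (s : ℝ) * (t : ℝ)

/-- Circular Brownian Motion, built from the law `B` of the Brownian Bridge: the (infinite) measure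
`A ↦ (2π)^(-1/2) ∫ B {p | p + c ∈ A} dc`, with `c` ranging over the line with Lebesgue measure. -/
def cbm (B : Measure Path) : Measure Path :=
  ENNReal.ofReal (1 / Real.sqrt (2 * Real.pi)) •
    ((volume : Measure ℝ).prod B).map
      (fun z : ℝ × Path => z.2 + ContinuousMap.const unitInterval z.1)

/-- `∫₀¹ p`. -/
def mean (p : Path) : ℝ := ∫ x : unitInterval, p x

/-- `∫₀¹ f p`. -/
def pairing (f : unitInterval → ℝ) (p : Path) : ℝ := ∫ x : unitInterval, f x * p x

/-- `Q` is the probability measure obtained by conditioning the (possibly infinite) measure `M` on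
`S = 0` and `T = 0`: the weak limit of the elementary conditional probabilities
`M( · | |S| ≤ ε, |T| ≤ h)` as `ε ↓ 0` and `h ↓ 0`. -/
structure IsConditionedAtZero (M : Measure Path) (S T : Path → ℝ) (Q : Measure Path) : Prop where
  isProbabilityMeasure : IsProbabilityMeasure Q
  tendsto : ∀ G : Path →ᵇ ℝ,
    Tendsto
      (fun r : ℝ × ℝ => ∫ p, G p ∂(ProbabilityTheory.cond M {p | |S p| ≤ r.1 ∧ |T p| ≤ r.2}))
      (𝓝[>] (0 : ℝ) ×ˢ 𝓝[>] (0 : ℝ)) (𝓝 (∫ p, G p ∂Q))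

/-- The path on `[0,1]` given by a continuous function on the line. -/
def restrictPath (f : ℝ → ℝ) (hf : Continuous f) : Path :=
  ⟨fun x => f x, hf.comp continuous_subtype_val⟩

end CircularBM

end

/-! The bridge law `B` is a centred Gaussian measure on path space. Since Lebesgue measure is
translation invariant, `cbm B` does not change when `B` is replaced by the law `μ` of the bridge
minus its mean (`map_add_const_eq`). The added constant is then exactly the mean of the path, and it
does not affect `∫ φ p` because `∫ φ = 0`. Conditioning on mean zero therefore fixes the constant at
`0`. Conditioning on `∫ φ p = 0` leaves the regression residual, which is independent of `∫ φ p`.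
The conditioned measure is thus the centred Gaussian law `ν` of the residual
(`isConditionedAtZero_residual`).

The identity is then `cameronMartin` for `ν` and `ℓ p = ∫ ψ'' p`. The bridge covariance is the
Green's function of the Dirichlet Laplacian, so under `B` the covariance vector of `ℓ` is `ψ 0 - ψ`.
Centring turns it into `-ψ`, and the residual map fixes `-ψ` because `∫ φ ψ = 0`. The variance of
`ℓ` is `-∫ ψ'' ψ = ∫ |ψ'|²`. -/

noncomputable section

/-! ### Gaussianity of the bridge law on path space -/

/-- A pointwise limit of centred real Gaussian variables is a centred Gaussian variable. -/
theorem exists_map_eq_gaussianReal_of_tendsto {Ω : Type*} [MeasurableSpace Ω] {P : Measure Ω}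
    [IsProbabilityMeasure P] {X : ℕ → Ω → ℝ} {Y : Ω → ℝ} (hX : ∀ n, HasGaussianLaw (X n) P)
    (h0 : ∀ n, ∫ ω, X n ω ∂P = 0) (hY : Measurable Y) (hXm : ∀ n, Measurable (X n))
    (hlim : ∀ ω, Tendsto (fun n => X n ω) atTop (𝓝 (Y ω))) :
    ∃ v, P.map Y = gaussianReal 0 v := by
  have hprob : IsProbabilityMeasure (P.map Y) := Measure.isProbabilityMeasure_map hY.aemeasurable
  have hchar : ∀ n t, charFun (P.map (X n)) t = Complex.exp (-(Var[X n; P] * t ^ 2 / 2 : ℝ)) := by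
    intro n t
    rw [(hX n).map_eq_gaussianReal, charFun_gaussianReal, h0 n]
    rw [Real.coe_toNNReal _ (variance_nonneg _ _)]
    push_cast
    congr 1
    ring
  have hconv : ∀ t, Tendsto (fun n => charFun (P.map (X n)) t) atTop (𝓝 (charFun (P.map Y) t)) := by
    intro t
    simp only [charFun_apply_real]
    simp_rw [fun n => integral_map (hXm n).aemeasurable (μ := P)
      (f := fun x : ℝ => Complex.exp (t * x * Complex.I)) (by fun_prop)]
    rw [integral_map hY.aemeasurable (by fun_prop)]
    refine tendsto_integral_of_dominated_convergence (fun _ => 1) ?_ (integrable_const _) ?_ ?_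
    · intro n
      have := hXm n
      exact Measurable.aestronglyMeasurable (by fun_prop)
    · intro n
      refine Eventually.of_forall fun ω => ?_
      rw [← Complex.ofReal_mul, Complex.norm_exp_ofReal_mul_I]
    · refine Eventually.of_forall fun ω => ?_
      have hc : Continuous fun x : ℝ => Complex.exp (t * x * Complex.I) := by fun_prop
      exact (hc.tendsto _).comp (hlim ω)
  -- One nonzero value of the limiting characteristic function suffices: solving `a = exp (-v t₀² /
  -- 2)` for `v` shows that the variances converge.
  obtain ⟨t₀, ht₀, hne⟩ : ∃ t₀ : ℝ, t₀ ≠ 0 ∧ charFun (P.map Y) t₀ ≠ 0 := by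
    have hc : ContinuousAt (charFun (P.map Y)) 0 := continuous_charFun.continuousAt
    have h1 : ∀ᶠ t in 𝓝 (0 : ℝ), charFun (P.map Y) t ≠ 0 := by
      refine hc.eventually_ne ?_
      simp
    have h2 : ∀ᶠ t in 𝓝[≠] (0 : ℝ), charFun (P.map Y) t ≠ 0 := h1.filter_mono nhdsWithin_le_nhds
    obtain ⟨t, ht, ht'⟩ := (h2.and self_mem_nhdsWithin).exists
    exact ⟨t, ht', ht⟩
  set a := ‖charFun (P.map Y) t₀‖ with ha
  have hapos : 0 < a := norm_pos_iff.2 hne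
  have hv : Tendsto (fun n => Var[X n; P]) atTop (𝓝 (-2 * Real.log a / t₀ ^ 2)) := by
    have h1 := ((Real.continuousAt_log hapos.ne').tendsto.comp (hconv t₀).norm)
    have h2 := (h1.const_mul (-2)).div_const (t₀ ^ 2)
    refine h2.congr fun n => ?_
    simp only [Function.comp_apply, hchar]
    rw [← Complex.ofReal_neg, Complex.norm_exp_ofReal, Real.log_exp]
    field_simp
  have hv0 : 0 ≤ -2 * Real.log a / t₀ ^ 2 :=
    ge_of_tendsto' hv fun n => variance_nonneg _ _
  refine ⟨(-2 * Real.log a / t₀ ^ 2).toNNReal, Measure.ext_of_charFun (funext fun t => ?_)⟩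
  refine tendsto_nhds_unique (hconv t) ?_
  simp_rw [hchar]
  rw [charFun_gaussianReal, Real.coe_toNNReal _ hv0]
  have hc : Continuous fun v : ℝ => Complex.exp (-(v * t ^ 2 / 2 : ℝ)) := by fun_prop
  have key : Complex.exp (t * ((0 : ℝ) : ℂ) * Complex.I - (-2 * Real.log a / t₀ ^ 2 : ℝ) * t ^ 2 / 2) =
      Complex.exp (-((-2 * Real.log a / t₀ ^ 2) * t ^ 2 / 2 : ℝ)) := by
    generalize -2 * Real.log a / t₀ ^ 2 = w
    congr 1
    push_cast
    ring
  rw [key]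
  exact (hc.tendsto _).comp hv

namespace CircularBM

theorem IsBrownianBridgeLaw.isProbabilityMeasure {B : Measure Path} (hB : IsBrownianBridgeLaw B) :
    IsProbabilityMeasure B := hB.isGaussianProcess.isProbabilityMeasure

/-- On a Bernstein approximation a functional `L` is a finite combination of point evaluations,
hence centred Gaussian; uniform convergence passes this to `L p`. -/
theorem IsBrownianBridgeLaw.isGaussian {B : Measure Path} (hB : IsBrownianBridgeLaw B) :
    IsGaussian B := by
  have := hB.isProbabilityMeasure
  refine isGaussian_of_map_eq_gaussianReal fun L => ⟨0, ?_⟩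
  have hev : ∀ t : unitInterval, Measurable fun p : Path => p t := fun t =>
    (continuous_eval_const t).measurable
  have hform : ∀ n (p : Path), L (bernsteinApproximation n p) =
      ∑ k : Fin (n + 1), L (bernstein n k) • p (bernstein.z k) := by
    intro n p
    have : bernsteinApproximation n p = ∑ k : Fin (n + 1), p (bernstein.z k) • bernstein n k := by
      ext x
      simp [bernsteinApproximation.apply, mul_comm]
    rw [this, map_sum]
    simp [mul_comm]
  refine exists_map_eq_gaussianReal_of_tendsto
    (X := fun n p => L (bernsteinApproximation n p)) (fun n => ?_) (fun n => ?_)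
    L.continuous.measurable (fun n => ?_) (fun p => ?_)
  · simp_rw [hform]
    exact (IsGaussianProcess.smul (fun k : Fin (n + 1) => L (bernstein n k))
      (hB.isGaussianProcess.comp_right fun k : Fin (n + 1) => bernstein.z k)).hasGaussianLaw_fun_sum
        (I := Finset.univ)
  · simp_rw [hform]
    rw [integral_finsetSum]
    · simp [integral_const_mul, hB.mean_eq_zero]
    · intro k _
      exact ((hB.isGaussianProcess.hasGaussianLaw_eval _).integrable).const_mul _
  · simp_rw [hform]
    exact Finset.measurable_fun_sum _ fun k _ => (hev (bernstein.z k)).const_smul (L (bernstein n k))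
  · exact (L.continuous.tendsto _).comp (bernsteinApproximation_uniform p)

end CircularBM

end

/-! ### Covariance vectors, regression and the Cameron–Martin formula -/

noncomputable section

/-- Exponential tilting of a centred real Gaussian measure is a translation. -/
theorem integral_gaussianReal_mul_exp (v : NNReal) (g : ℝ → ℝ) :
    ∫ s, g s * Real.exp (s - v / 2) ∂(gaussianReal 0 v) = ∫ s, g (s + v) ∂(gaussianReal 0 v) := by
  rcases eq_or_ne v 0 with rfl | hv
  · simp
  have h1 : ∫ s, g (s + v) ∂(gaussianReal 0 v) = ∫ s, g s ∂(gaussianReal v v) := by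
    have h := gaussianReal_map_add_const (μ := 0) (v := v) (v : ℝ)
    rw [zero_add] at h
    rw [← h]
    exact (((MeasurableEquiv.addRight (v : ℝ)).measurableEmbedding).integral_map g).symm
  rw [h1, integral_gaussianReal_eq_integral_smul hv, integral_gaussianReal_eq_integral_smul hv]
  congr 1
  ext s
  have hv' : (v : ℝ) ≠ 0 := by exact_mod_cast hv
  -- Completing the square: `-(s - v)² / (2v) = -s² / (2v) + s - v / 2`.
  have : gaussianPDFReal v v s = gaussianPDFReal 0 v s * Real.exp (s - v / 2) := by
    simp only [gaussianPDFReal]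
    rw [mul_assoc _ (Real.exp _), ← Real.exp_add]
    congr 2
    field_simp
    ring
  rw [this]
  simp only [smul_eq_mul]
  ring

namespace GaussianMeasure

variable {E F : Type*} [NormedAddCommGroup E] [NormedSpace ℝ E] [CompleteSpace E]
  [SecondCountableTopology E] [MeasurableSpace E] [BorelSpace E]
  [NormedAddCommGroup F] [NormedSpace ℝ F] [CompleteSpace F]
  [SecondCountableTopology F] [MeasurableSpace F] [BorelSpace F]

/-- The covariance operator of a centred measure, from the dual space to the space. -/
def covVec (μ : Measure E) (ℓ : StrongDual ℝ E) : E := ∫ p, ℓ p • p ∂μ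

theorem integrable_smul_self (μ : Measure E) [IsGaussian μ] (ℓ : StrongDual ℝ E) :
    Integrable (fun p => ℓ p • p) μ :=
  memLp_one_iff_integrable.1 <| (IsGaussian.memLp_two_id (μ := μ)).smul (p := 2) (q := 2)
    (IsGaussian.memLp_dual μ ℓ 2 (by simp))

theorem apply_covVec (μ : Measure E) [IsGaussian μ] (ℓ L : StrongDual ℝ E) :
    L (covVec μ ℓ) = ∫ p, ℓ p * L p ∂μ := by
  rw [covVec, ← L.integral_comp_comm (integrable_smul_self μ ℓ)]
  simp

theorem apply_covVec_comm (μ : Measure E) [IsGaussian μ] (ℓ L : StrongDual ℝ E) :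
    L (covVec μ ℓ) = ℓ (covVec μ L) := by
  simp_rw [apply_covVec, mul_comm]

theorem covVec_map (μ : Measure E) [IsGaussian μ] (A : E →L[ℝ] F) (ℓ : StrongDual ℝ F) :
    covVec (μ.map A) ℓ = A (covVec μ (ℓ ∘L A)) := by
  rw [covVec, covVec, integral_map A.continuous.aemeasurable
    (Continuous.aestronglyMeasurable (by fun_prop)),
    ← A.integral_comp_comm (integrable_smul_self μ _)]
  simp

theorem covVec_sub_smul (μ : Measure E) [IsGaussian μ] (ℓ T : StrongDual ℝ E) (c : ℝ) :
    covVec μ (ℓ - c • T) = covVec μ ℓ - c • covVec μ T := by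
  rw [covVec, covVec, covVec, ← integral_smul,
    ← integral_sub (integrable_smul_self μ ℓ) ((integrable_smul_self μ T).fun_smul c)]
  congr 1
  ext p
  simp [sub_smul, mul_smul]

theorem integral_map_eq_zero (μ : Measure E) [IsGaussian μ] (hμ : ∫ p, p ∂μ = 0) (A : E →L[ℝ] F) :
    ∫ p, p ∂(μ.map A) = 0 := by
  rw [integral_map A.continuous.aemeasurable (Continuous.aestronglyMeasurable (by fun_prop)),
    A.integral_comp_comm IsGaussian.integrable_fun_id, hμ, map_zero]

theorem apply_covVec_self_nonneg (μ : Measure E) [IsGaussian μ] (ℓ : StrongDual ℝ E) :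
    0 ≤ ℓ (covVec μ ℓ) := by
  rw [apply_covVec]
  exact integral_nonneg fun p => mul_self_nonneg _

theorem covVec_eq_zero (μ : Measure E) [IsGaussian μ] (ℓ : StrongDual ℝ E)
    (h : ℓ (covVec μ ℓ) = 0) : covVec μ ℓ = 0 := by
  rw [apply_covVec, integral_eq_zero_iff_of_nonneg (fun p => mul_self_nonneg _)] at h
  · refine integral_eq_zero_of_ae ?_
    filter_upwards [h] with p hp
    simp [mul_self_eq_zero.1 hp]
  · exact MemLp.integrable_mul (p := 2) (q := 2) (IsGaussian.memLp_dual μ ℓ 2 (by simp))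
      (IsGaussian.memLp_dual μ ℓ 2 (by simp))

/-- The direction `cov(p, ℓ) / Var ℓ` (zero if `ℓ` is degenerate). -/
def regVec (μ : Measure E) (ℓ : StrongDual ℝ E) : E := (ℓ (covVec μ ℓ))⁻¹ • covVec μ ℓ

/-- In the degenerate case `ℓ` vanishes almost everywhere, so its covariance vector is zero and the
convention `0⁻¹ = 0` is harmless. -/
theorem smul_regVec (μ : Measure E) [IsGaussian μ] (ℓ : StrongDual ℝ E) :
    ℓ (covVec μ ℓ) • regVec μ ℓ = covVec μ ℓ := by
  by_cases h : ℓ (covVec μ ℓ) = 0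
  · rw [covVec_eq_zero μ ℓ h]; simp
  · rw [regVec, smul_inv_smul₀ h]

/-- The part of a Gaussian vector that is independent of `ℓ`. -/
def residual (μ : Measure E) (ℓ : StrongDual ℝ E) : E →L[ℝ] E :=
  ContinuousLinearMap.id ℝ E - ℓ.smulRight (regVec μ ℓ)

omit [CompleteSpace E] [SecondCountableTopology E] [BorelSpace E] in
theorem residual_apply (μ : Measure E) (ℓ : StrongDual ℝ E) (p : E) :
    residual μ ℓ p = p - ℓ p • regVec μ ℓ := by
  simp [residual]

theorem residual_covVec (μ : Measure E) [IsGaussian μ] (ℓ : StrongDual ℝ E) :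
    residual μ ℓ (covVec μ ℓ) = 0 := by
  rw [residual_apply, smul_regVec, sub_self]

/-- Composing `ℓ` with the residual map changes it by a multiple of `T`, whose covariance vector
that map annihilates. -/
theorem covVec_map_residual (μ : Measure E) [IsGaussian μ] (T ℓ : StrongDual ℝ E) :
    covVec (μ.map (residual μ T)) ℓ = residual μ T (covVec μ ℓ) := by
  have h : ℓ ∘L residual μ T = ℓ - ℓ (regVec μ T) • T := by
    ext p
    simp [residual_apply, mul_comm]
  rw [covVec_map, h, covVec_sub_smul, map_sub, map_smul, residual_covVec, smul_zero, sub_zero]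

/-- Jointly Gaussian and uncorrelated implies independent. Both Cameron–Martin and the conditioning
rest on this splitting. -/
theorem map_prod_residual (μ : Measure E) [IsGaussian μ] (hμ : ∫ p, p ∂μ = 0)
    (ℓ : StrongDual ℝ E) :
    μ.map (fun p => (ℓ p, residual μ ℓ p)) = (μ.map ℓ).prod (μ.map (residual μ ℓ)) := by
  have hind : IndepFun ℓ (residual μ ℓ) μ := by
    refine HasGaussianLaw.indepFun_of_covariance_strongDual ⟨?_⟩ ?_
    · exact isGaussian_map (ℓ.prod (residual μ ℓ))
    · intro L₁ L₂
      have hL : ∀ L : StrongDual ℝ E, ∫ p, L p ∂μ = 0 := fun L => by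
        rw [IsGaussian.integral_dual, hμ, map_zero]
      have e1 : L₁ ∘ ℓ = ⇑(L₁ ∘L ℓ) := rfl
      have e2 : L₂ ∘ residual μ ℓ = ⇑(L₂ ∘L residual μ ℓ) := rfl
      rw [e1, e2, covariance_eq_sub (IsGaussian.memLp_dual μ _ 2 (by simp))
        (IsGaussian.memLp_dual μ _ 2 (by simp)), hL, hL, mul_zero, sub_zero]
      have e3 : ∀ p, (L₁ ∘L ℓ) p = L₁ 1 * ℓ p := fun p => by
        have : L₁ (ℓ p) = L₁ (ℓ p • 1) := by simp
        rw [ContinuousLinearMap.comp_apply, this, map_smul, smul_eq_mul, mul_comm]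
      simp only [Pi.mul_apply, e3, mul_assoc]
      rw [integral_const_mul, ← apply_covVec, ContinuousLinearMap.comp_apply, residual_covVec]
      simp
  exact (indepFun_iff_map_prod_eq_prod_map_map ℓ.continuous.aemeasurable
    (residual μ ℓ).continuous.aemeasurable).1 hind

theorem map_eq_gaussianReal (μ : Measure E) [IsGaussian μ] (hμ : ∫ p, p ∂μ = 0)
    (ℓ : StrongDual ℝ E) : μ.map ℓ = gaussianReal 0 (ℓ (covVec μ ℓ)).toNNReal := by
  have h : ∫ p, ℓ p ∂μ = 0 := by rw [IsGaussian.integral_dual, hμ, map_zero]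
  rw [IsGaussian.map_eq_gaussianReal, h, apply_covVec,
    variance_of_integral_eq_zero ℓ.continuous.aemeasurable h]
  simp_rw [sq]

/-- The Cameron–Martin formula. -/
theorem cameronMartin (μ : Measure E) [IsGaussian μ] (hμ : ∫ p, p ∂μ = 0)
    (ℓ : StrongDual ℝ E) {G : E → ℝ} (hG : Measurable G) {C : ℝ} (hC : ∀ p, |G p| ≤ C) :
    Integrable (fun p => G p * Real.exp (ℓ p - ℓ (covVec μ ℓ) / 2)) μ ∧
    ∫ p, G p * Real.exp (ℓ p - ℓ (covVec μ ℓ) / 2) ∂μ = ∫ p, G (p + covVec μ ℓ) ∂μ := by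
  set V := ℓ (covVec μ ℓ) with hV
  have hV0 : 0 ≤ V := apply_covVec_self_nonneg μ ℓ
  have hℓ : Measurable ℓ := ℓ.continuous.measurable
  have hlaw := map_eq_gaussianReal μ hμ ℓ
  rw [← hV] at hlaw
  have hexp : Integrable (fun p => Real.exp (ℓ p - V / 2)) μ := by
    have h1 : Integrable (fun s : ℝ => Real.exp (1 * s)) (μ.map ℓ) := by
      rw [hlaw]; exact integrable_exp_mul_gaussianReal 1
    have h2 := (h1.comp_measurable hℓ).div_const (Real.exp (V / 2))
    refine h2.congr (Eventually.of_forall fun p => ?_)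
    simp [Real.exp_sub]
  have hint : Integrable (fun p => G p * Real.exp (ℓ p - V / 2)) μ :=
    hexp.bdd_mul hG.aestronglyMeasurable (Eventually.of_forall hC)
  refine ⟨hint, ?_⟩
  -- In `p = residual + ℓ p • u` the exponential weight sees only the scalar `ℓ p`. Tilting shifts
  -- that scalar by `V`, hence the path by `V • u = covVec μ ℓ`; Fubini reduces the claim to one
  -- dimension.
  set u := regVec μ ℓ
  set ν := μ.map (residual μ ℓ)
  set N := μ.map ℓ
  have hpair : Measurable fun p => (ℓ p, residual μ ℓ p) := by fun_prop
  have hprod : μ.map (fun p => (ℓ p, residual μ ℓ p)) = N.prod ν := map_prod_residual μ hμ ℓ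
  have hrec : ∀ p, residual μ ℓ p + ℓ p • u = p := fun p => by rw [residual_apply]; simp [u]
  have hVu : covVec μ ℓ = V • u := (smul_regVec μ ℓ).symm
  have hm1 : Measurable fun z : ℝ × E => G (z.2 + z.1 • u) * Real.exp (z.1 - V / 2) := by fun_prop
  have hm2 : Measurable fun z : ℝ × E => G (z.2 + z.1 • u + V • u) := by fun_prop
  have h1 : ∫ p, G p * Real.exp (ℓ p - V / 2) ∂μ =
      ∫ z, G (z.2 + z.1 • u) * Real.exp (z.1 - V / 2) ∂(N.prod ν) := by
    rw [← hprod, integral_map hpair.aemeasurable hm1.aestronglyMeasurable]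
    simp_rw [hrec]
  have h2 : ∫ p, G (p + covVec μ ℓ) ∂μ = ∫ z, G (z.2 + z.1 • u + V • u) ∂(N.prod ν) := by
    rw [← hprod, integral_map hpair.aemeasurable hm2.aestronglyMeasurable]
    simp_rw [hrec, hVu]
  have hi1 : Integrable (fun z : ℝ × E => G (z.2 + z.1 • u) * Real.exp (z.1 - V / 2))
      (N.prod ν) := by
    rw [← hprod, integrable_map_measure hm1.aestronglyMeasurable hpair.aemeasurable]
    refine hint.congr (Eventually.of_forall fun p => ?_)
    simp [hrec]
  have hNprob : IsProbabilityMeasure N := Measure.isProbabilityMeasure_map hℓ.aemeasurable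
  have hνprob : IsProbabilityMeasure ν :=
    Measure.isProbabilityMeasure_map (residual μ ℓ).continuous.aemeasurable
  have hi2 : Integrable (fun z : ℝ × E => G (z.2 + z.1 • u + V • u)) (N.prod ν) :=
    Integrable.of_bound hm2.aestronglyMeasurable C (Eventually.of_forall fun z => hC _)
  rw [h1, h2, integral_prod_symm _ hi1, integral_prod_symm _ hi2]
  congr 1
  ext x
  have := integral_gaussianReal_mul_exp V.toNNReal fun s => G (x + s • u)
  rw [Real.coe_toNNReal _ hV0] at this
  rw [hlaw, this]
  simp_rw [add_smul, add_assoc]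

end GaussianMeasure

end

/-! ### Conditioning circular Brownian motion -/

noncomputable section

namespace CircularBM

open GaussianMeasure

/-- `p ↦ ∫₀¹ f p` as a continuous linear functional. -/
def pairingCLM (f : C(unitInterval, ℝ)) : Path →L[ℝ] ℝ :=
  LinearMap.mkContinuous
    { toFun := fun p => ∫ x : unitInterval, f x * p x
      map_add' := fun p q => by
        simp only [ContinuousMap.add_apply, mul_add]
        exact integral_add ((f * p).continuous.integrable_of_hasCompactSupport
          (HasCompactSupport.of_compactSpace _))
          ((f * q).continuous.integrable_of_hasCompactSupport
          (HasCompactSupport.of_compactSpace _))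
      map_smul' := fun c p => by
        simp only [ContinuousMap.smul_apply, smul_eq_mul, RingHom.id_apply]
        rw [← integral_const_mul]
        congr 1
        ext x
        ring }
    ‖f‖ fun p => by
      simp only [LinearMap.coe_mk, AddHom.coe_mk]
      refine (norm_integral_le_of_norm_le_const (C := ‖f‖ * ‖p‖)
        (Eventually.of_forall fun x => ?_)).trans (by simp)
      rw [norm_mul]
      exact mul_le_mul (f.norm_coe_le_norm x) (p.norm_coe_le_norm x) (norm_nonneg _) (norm_nonneg _)

theorem pairingCLM_apply (f : C(unitInterval, ℝ)) (p : Path) :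
    pairingCLM f p = ∫ x : unitInterval, f x * p x := rfl

theorem pairingCLM_const (f : C(unitInterval, ℝ)) (hf : ∫ x : unitInterval, f x = 0) (c : ℝ) :
    pairingCLM f (ContinuousMap.const _ c) = 0 := by
  simp [pairingCLM_apply, integral_mul_const, hf]

theorem mean_eq_pairingCLM (p : Path) : mean p = pairingCLM 1 p := by
  simp [mean, pairingCLM_apply]

theorem continuous_mean : Continuous mean := by
  simp_rw [funext mean_eq_pairingCLM]
  exact (pairingCLM 1).continuous

theorem mean_add_const (p : Path) (c : ℝ) :
    mean (p + ContinuousMap.const _ c) = mean p + c := by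
  simp_rw [mean_eq_pairingCLM, map_add]
  simp [pairingCLM_apply]

/-- Subtraction of the mean. -/
def centre : Path →L[ℝ] Path :=
  ContinuousLinearMap.id ℝ Path - (pairingCLM 1).smulRight (1 : Path)

theorem centre_apply (p : Path) : centre p = p - ContinuousMap.const _ (mean p) := by
  ext t
  simp [centre, mean_eq_pairingCLM]

theorem mean_centre (p : Path) : mean (centre p) = 0 := by
  have := mean_add_const (centre p) (mean p)
  rw [centre_apply, sub_add_cancel] at this
  rw [centre_apply]
  linarith

theorem measurable_add_const :
    Measurable fun z : ℝ × Path => z.2 + ContinuousMap.const unitInterval z.1 :=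
  Continuous.measurable (continuous_snd.add (ContinuousMap.continuous_const'.comp continuous_fst))

/-- For each fixed path `b`, the constant absorbs `mean b` by translation invariance of Lebesgue
measure. -/
theorem map_add_const_eq (B : Measure Path) [IsProbabilityMeasure B] :
    ((volume : Measure ℝ).prod B).map
      (fun z : ℝ × Path => z.2 + ContinuousMap.const unitInterval z.1) =
    ((volume : Measure ℝ).prod (B.map centre)).map
      (fun z : ℝ × Path => z.2 + ContinuousMap.const unitInterval z.1) := by
  have : IsProbabilityMeasure (B.map centre) :=
    Measure.isProbabilityMeasure_map centre.continuous.aemeasurable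
  ext s hs
  have hs' := measurable_add_const hs
  rw [Measure.map_apply measurable_add_const hs, Measure.map_apply measurable_add_const hs,
    Measure.prod_apply_symm hs', Measure.prod_apply_symm hs',
    lintegral_map (measurable_measure_prodMk_right hs') centre.continuous.measurable]
  congr 1
  ext b
  refine Eq.trans ?_ (measure_preimage_add_right volume (mean b) _)
  congr 1
  ext c
  simp only [Set.mem_preimage]
  have : b + ContinuousMap.const unitInterval c =
      centre b + ContinuousMap.const unitInterval (c + mean b) := by
    rw [centre_apply]
    ext t
    simp
  rw [this]

/-- Averages over small boxes around the origin converge to the value at the origin. -/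
theorem tendsto_integral_cond_box {ρ : Measure (ℝ × ℝ)} {g : ℝ × ℝ → ℝ} (hg : Continuous g)
    {C : ℝ} (hC : ∀ w, |g w| ≤ C)
    (hpos : ∀ ε h : ℝ, 0 < ε → 0 < h → ρ {w | |w.1| ≤ ε ∧ |w.2| ≤ h} ≠ 0)
    (hfin : ∀ ε h : ℝ, 0 < ε → 0 < h → ρ {w | |w.1| ≤ ε ∧ |w.2| ≤ h} ≠ ⊤) :
    Tendsto (fun r : ℝ × ℝ => ∫ w, g w ∂(ProbabilityTheory.cond ρ {w | |w.1| ≤ r.1 ∧ |w.2| ≤ r.2}))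
      (𝓝[>] (0 : ℝ) ×ˢ 𝓝[>] (0 : ℝ)) (𝓝 (g 0)) := by
  rw [Metric.tendsto_nhds]
  intro δ hδ
  obtain ⟨η, hη, hgη⟩ := Metric.continuous_iff.1 hg 0 (δ / 2) (half_pos hδ)
  filter_upwards [prod_mem_prod (Ioo_mem_nhdsGT hη) (Ioo_mem_nhdsGT hη)] with r hr
  obtain ⟨⟨h1, h1'⟩, h2, h2'⟩ := hr
  set box : Set (ℝ × ℝ) := {w | |w.1| ≤ r.1 ∧ |w.2| ≤ r.2} with hbox
  have hbm : MeasurableSet box :=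
    (measurableSet_le measurable_fst.abs measurable_const).inter
      (measurableSet_le measurable_snd.abs measurable_const)
  have hprob : IsProbabilityMeasure (ProbabilityTheory.cond ρ box) :=
    cond_isProbabilityMeasure_of_finite (hpos _ _ h1 h2) (hfin _ _ h1 h2)
  have hint : Integrable g (ProbabilityTheory.cond ρ box) :=
    Integrable.of_bound hg.aestronglyMeasurable C (Eventually.of_forall hC)
  have hsub : ∫ w, g w ∂(ProbabilityTheory.cond ρ box) - g 0 =
      ∫ w, (g w - g 0) ∂(ProbabilityTheory.cond ρ box) := by
    rw [integral_sub hint (integrable_const _)]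
    simp
  rw [Real.dist_eq, hsub, ← Real.norm_eq_abs]
  have hle := norm_integral_le_of_norm_le_const (μ := ProbabilityTheory.cond ρ box)
    (f := fun w => g w - g 0) (C := δ / 2) ?_
  · rw [probReal_univ, mul_one] at hle
    linarith
  · filter_upwards [ae_cond_mem hbm] with w hw
    rw [← dist_eq_norm]
    refine (hgη w ?_).le
    rw [Prod.dist_eq, max_lt_iff]
    simp only [Prod.fst_zero, Prod.snd_zero, Real.dist_eq, sub_zero]
    exact ⟨hw.1.trans_lt h1', hw.2.trans_lt h2'⟩

theorem gaussianReal_abs_le_ne_zero (v : NNReal) {h : ℝ} (hh : 0 < h) :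
    gaussianReal 0 v {s | |s| ≤ h} ≠ 0 := by
  rcases eq_or_ne v 0 with rfl | hv
  · rw [gaussianReal_zero_var, Measure.dirac_apply_of_mem]
    · simp
    · simpa using hh.le
  · intro h0
    have h1 : volume {s : ℝ | |s| ≤ h} = 0 := gaussianReal_absolutelyContinuous' 0 hv h0
    have h2 : {s : ℝ | |s| ≤ h} = Set.Icc (-h) h := by ext s; simp [abs_le]
    rw [h2, Real.volume_Icc] at h1
    simp at h1
    linarith

/-- Conditioning the independent sum of a mean-zero centred Gaussian path and a uniform constant
produces the part of the path that is independent of the conditioning functional. -/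
theorem isConditionedAtZero_residual (μ : Measure Path) [IsGaussian μ] (hμ : ∫ p, p ∂μ = 0)
    (hmean : ∀ᵐ p ∂μ, mean p = 0) (φ : C(unitInterval, ℝ)) (hφ : ∫ x : unitInterval, φ x = 0)
    (c : ENNReal) (hc0 : c ≠ 0) (hctop : c ≠ ⊤) :
    IsConditionedAtZero (c • ((volume : Measure ℝ).prod μ).map
      (fun z : ℝ × Path => z.2 + ContinuousMap.const unitInterval z.1))
      mean (pairing φ) (μ.map (residual μ (pairingCLM φ))) := by
  set T := pairingCLM φ with hT
  set u := regVec μ T with hu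
  set X := residual μ T with hX
  set ν := μ.map X
  set N := μ.map T with hN
  have hTm : Measurable T := T.continuous.measurable
  have hXm : Measurable X := X.continuous.measurable
  have hNprob : IsProbabilityMeasure N := Measure.isProbabilityMeasure_map hTm.aemeasurable
  have hνprob : IsProbabilityMeasure ν := Measure.isProbabilityMeasure_map hXm.aemeasurable
  -- `Θ` extracts the independent coordinates: constant, value of `T`, residual. `Φ` reassembles the
  -- path from them.
  set Θ : ℝ × Path → (ℝ × ℝ) × Path := fun z => ((z.1, T z.2), X z.2) with hΘ
  have hΘm : Measurable Θ := by fun_prop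
  set Φ : (ℝ × ℝ) × Path → Path := fun z =>
    z.2 + z.1.2 • u + ContinuousMap.const unitInterval z.1.1 with hΦ
  have hΦc : Continuous Φ :=
    (continuous_snd.add ((continuous_snd.comp continuous_fst).smul continuous_const)).add
      (ContinuousMap.continuous_const'.comp (continuous_fst.comp continuous_fst))
  have hΦm : Measurable Φ := hΦc.measurable
  have hlaw : ((volume : Measure ℝ).prod μ).map Θ = ((volume : Measure ℝ).prod N).prod ν := by
    have h1 : ((volume : Measure ℝ).prod μ).map (Prod.map id fun p => (T p, X p)) =
        (volume : Measure ℝ).prod (N.prod ν) := by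
      rw [← Measure.map_prod_map _ _ measurable_id (by fun_prop), Measure.map_id,
        map_prod_residual μ hμ T]
    have h2 : ((volume : Measure ℝ).prod (N.prod ν)).map MeasurableEquiv.prodAssoc.symm =
        ((volume : Measure ℝ).prod N).prod ν := by
      rw [← Measure.prodAssoc_prod, MeasurableEquiv.map_symm_map]
    rw [← h2, ← h1, Measure.map_map (MeasurableEquiv.measurable _) (by fun_prop)]
    rfl
  have hΦΘ : ∀ z, Φ (Θ z) = z.2 + ContinuousMap.const unitInterval z.1 := fun z => by
    simp [hΦ, hΘ, hX, residual_apply, hu]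
  have hM : ((volume : Measure ℝ).prod μ).map
      (fun z : ℝ × Path => z.2 + ContinuousMap.const unitInterval z.1) =
      (((volume : Measure ℝ).prod N).prod ν).map Φ := by
    rw [← hlaw, Measure.map_map hΦm hΘm]
    congr 1
    ext1 z
    exact (hΦΘ z).symm
  -- Only almost everywhere: an arbitrary triple need not come from a mean-zero path, so the claim
  -- is pulled back along `Θ`.
  have hae : ∀ᵐ z ∂(((volume : Measure ℝ).prod N).prod ν),
      mean (Φ z) = z.1.1 ∧ pairing φ (Φ z) = z.1.2 := by
    have hms : MeasurableSet {z | mean (Φ z) = z.1.1 ∧ pairing φ (Φ z) = z.1.2} :=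
      (measurableSet_eq_fun (continuous_mean.measurable.comp hΦm) (by fun_prop)).inter
        (measurableSet_eq_fun (hTm.comp hΦm) (by fun_prop))
    rw [← hlaw, ae_map_iff hΘm.aemeasurable hms]
    have h1 : ∀ᵐ z ∂((volume : Measure ℝ).prod μ), mean z.2 = 0 :=
      Measure.quasiMeasurePreserving_snd.ae hmean
    filter_upwards [h1] with z hz
    rw [hΦΘ]
    refine ⟨by rw [mean_add_const, hz, zero_add], ?_⟩
    change T _ = T z.2
    rw [map_add, hT, pairingCLM_const φ hφ, add_zero]
  have hcond : ∀ r : ℝ × ℝ, ProbabilityTheory.cond (c • ((volume : Measure ℝ).prod μ).map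
      (fun z : ℝ × Path => z.2 + ContinuousMap.const unitInterval z.1))
        {p | |mean p| ≤ r.1 ∧ |pairing φ p| ≤ r.2} =
      ((ProbabilityTheory.cond ((volume : Measure ℝ).prod N)
        {w | |w.1| ≤ r.1 ∧ |w.2| ≤ r.2}).prod ν).map Φ := by
    intro r
    set A : Set Path := {p | |mean p| ≤ r.1 ∧ |pairing φ p| ≤ r.2} with hA
    set box : Set (ℝ × ℝ) := {w | |w.1| ≤ r.1 ∧ |w.2| ≤ r.2} with hbox
    have hAm : MeasurableSet A :=
      (measurableSet_le (continuous_mean.measurable.abs) measurable_const).inter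
        (measurableSet_le (show Measurable fun p => |T p| from hTm.abs) measurable_const)
    -- Up to a null set the conditioning event constrains only the two scalars, so the residual
    -- keeps its law `ν`.
    have hpre : Φ ⁻¹' A =ᵐ[((volume : Measure ℝ).prod N).prod ν] box ×ˢ Set.univ := by
      filter_upwards [hae] with z hz
      refine propext ?_
      change (|mean (Φ z)| ≤ r.1 ∧ |pairing φ (Φ z)| ≤ r.2) ↔ (z.1 ∈ box ∧ z.2 ∈ Set.univ)
      rw [hz.1, hz.2]
      simp [hbox]
    have hres : (((volume : Measure ℝ).prod N).prod ν).restrict (Φ ⁻¹' A) =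
        (((volume : Measure ℝ).prod N).restrict box).prod ν := by
      rw [Measure.restrict_congr_set hpre, ← Measure.prod_restrict, Measure.restrict_univ]
    have hval : (((volume : Measure ℝ).prod N).prod ν) (Φ ⁻¹' A) =
        ((volume : Measure ℝ).prod N) box := by
      rw [measure_congr hpre, Measure.prod_prod, measure_univ, mul_one]
    have hscal : (c * ((volume : Measure ℝ).prod N) box)⁻¹ * c =
        (((volume : Measure ℝ).prod N) box)⁻¹ := by
      rw [ENNReal.mul_inv (Or.inl hc0) (Or.inl hctop), mul_comm, ← mul_assoc,
        ENNReal.mul_inv_cancel hc0 hctop, one_mul]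
    rw [hM, ProbabilityTheory.cond, ProbabilityTheory.cond, Measure.smul_apply,
      Measure.map_apply hΦm hAm, hval, Measure.restrict_smul, Measure.restrict_map hΦm hAm, hres,
      smul_smul, smul_eq_mul, hscal, Measure.prod_smul_left, Measure.map_smul]
  refine ⟨hνprob, fun G => ?_⟩
  have hGΦ : Continuous fun z => G (Φ z) := G.continuous.comp hΦc
  -- With the residual integrated out, the conditional expectation is an average of the continuous
  -- `g` over a shrinking box, and `Φ (0, x) = x` identifies the limit.
  set g : ℝ × ℝ → ℝ := fun w => ∫ x, G (Φ (w, x)) ∂ν with hg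
  have hgc : Continuous g := by
    refine continuous_of_dominated (bound := fun _ => ‖G‖) (fun w => ?_) (fun w => ?_)
      (integrable_const _) ?_
    · exact (hGΦ.comp (Continuous.prodMk_right w)).aestronglyMeasurable
    · exact Eventually.of_forall fun x => G.norm_coe_le_norm _
    · exact Eventually.of_forall fun x => hGΦ.comp (Continuous.prodMk_left x)
  have hgb : ∀ w, |g w| ≤ ‖G‖ := fun w => by
    have := norm_integral_le_of_norm_le_const (μ := ν) (f := fun x => G (Φ (w, x))) (C := ‖G‖)
      (Eventually.of_forall fun x => G.norm_coe_le_norm _)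
    rwa [probReal_univ, mul_one] at this
  have hg0 : g 0 = ∫ p, G p ∂ν := by
    simp only [hg]
    congr 1
    ext x
    congr 1
    ext t
    simp [hΦ]
  have hboxval : ∀ ε h : ℝ, ((volume : Measure ℝ).prod N) {w | |w.1| ≤ ε ∧ |w.2| ≤ h} =
      ENNReal.ofReal (2 * ε) * N {s | |s| ≤ h} := by
    intro ε h
    have h1 : {w : ℝ × ℝ | |w.1| ≤ ε ∧ |w.2| ≤ h} = Set.Icc (-ε) ε ×ˢ {s | |s| ≤ h} := by
      ext w; simp [abs_le]
    rw [h1, Measure.prod_prod, Real.volume_Icc]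
    congr 2
    ring
  have hpos : ∀ ε h : ℝ, 0 < ε → 0 < h →
      ((volume : Measure ℝ).prod N) {w | |w.1| ≤ ε ∧ |w.2| ≤ h} ≠ 0 := by
    intro ε h hε hh
    rw [hboxval, hN, map_eq_gaussianReal μ hμ T]
    refine mul_ne_zero ?_ (gaussianReal_abs_le_ne_zero _ hh)
    simpa using hε
  have hfin : ∀ ε h : ℝ, 0 < ε → 0 < h →
      ((volume : Measure ℝ).prod N) {w | |w.1| ≤ ε ∧ |w.2| ≤ h} ≠ ⊤ := by
    intro ε h hε hh
    rw [hboxval]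
    exact ENNReal.mul_ne_top ENNReal.ofReal_ne_top (measure_ne_top _ _)
  rw [← hg0]
  refine (tendsto_integral_cond_box hgc hgb hpos hfin).congr fun r => ?_
  rw [hcond, integral_map hΦm.aemeasurable G.continuous.aestronglyMeasurable,
    integral_prod _ (Integrable.of_bound hGΦ.aestronglyMeasurable ‖G‖
      (Eventually.of_forall fun z => G.norm_coe_le_norm _))]

theorem IsConditionedAtZero.unique {M : Measure Path} {S T : Path → ℝ} {Q Q' : Measure Path}
    (h : IsConditionedAtZero M S T Q) (h' : IsConditionedAtZero M S T Q') : Q = Q' := by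
  have := h.isProbabilityMeasure
  have := h'.isProbabilityMeasure
  exact ext_of_forall_integral_eq_of_IsFiniteMeasure fun G =>
    tendsto_nhds_unique (h.tendsto G) (h'.tendsto G)

end CircularBM

end

/-! ### Green's function and integration by parts -/

noncomputable section

namespace CircularBM

open GaussianMeasure

theorem integral_unitInterval (f : ℝ → ℝ) : ∫ x : unitInterval, f x = ∫ x in (0 : ℝ)..1, f x := by
  rw [intervalIntegral.integral_of_le zero_le_one, ← integral_Icc_eq_integral_Ioc]
  exact integral_subtype_comap measurableSet_Icc f

theorem hasDerivAt_deriv_of_contDiff_two {ψ : ℝ → ℝ} (hψ : ContDiff ℝ 2 ψ) :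
    (∀ x, HasDerivAt ψ (deriv ψ x) x) ∧ (∀ x, HasDerivAt (deriv ψ) (deriv (deriv ψ) x) x) ∧
      Continuous (deriv (deriv ψ)) := by
  have h1 : ContDiff ℝ 1 (deriv ψ) := ContDiff.deriv' (n := 1) (by simpa [one_add_one_eq_two])
  exact ⟨fun x => (hψ.differentiable (by norm_num) x).hasDerivAt,
    fun x => (h1.differentiable (by norm_num) x).hasDerivAt, h1.continuous_deriv le_rfl⟩

/-- Green's function of the Dirichlet Laplacian on `[0,1]`. -/
theorem integral_deriv_deriv_mul_green {ψ : ℝ → ℝ} (hψ : ContDiff ℝ 2 ψ) (h01 : ψ 0 = ψ 1)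
    (t : unitInterval) :
    ∫ x : unitInterval, deriv (deriv ψ) x * (min (x : ℝ) (t : ℝ) - (x : ℝ) * (t : ℝ)) =
      ψ 0 - ψ t := by
  obtain ⟨hd, hd', hc⟩ := hasDerivAt_deriv_of_contDiff_two hψ
  rw [integral_unitInterval fun x => deriv (deriv ψ) x * (min x (t : ℝ) - x * t)]
  set f : ℝ → ℝ := fun x => deriv (deriv ψ) x * (min x (t : ℝ) - x * t) with hf
  have hfc : Continuous f := by fun_prop
  rw [← intervalIntegral.integral_add_adjacent_intervals (b := (t : ℝ))
    (hfc.intervalIntegrable _ _) (hfc.intervalIntegrable _ _)]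
  -- The kernel is `(1 - t) x` left of `t` and `t (1 - x)` right of it; after integration by parts
  -- the `deriv ψ t` terms cancel.
  have h1 : ∫ x in (0 : ℝ)..t, f x = ∫ x in (0 : ℝ)..t, (1 - (t : ℝ)) * (x * deriv (deriv ψ) x) := by
    refine intervalIntegral.integral_congr fun x hx => ?_
    rw [Set.uIcc_of_le t.2.1] at hx
    simp only [hf, min_eq_left hx.2]
    ring
  have h2 : ∫ x in (t : ℝ)..1, f x = ∫ x in (t : ℝ)..1, (t : ℝ) * ((1 - x) * deriv (deriv ψ) x) := by
    refine intervalIntegral.integral_congr fun x hx => ?_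
    rw [Set.uIcc_of_le t.2.2] at hx
    simp only [hf, min_eq_right hx.1]
    ring
  have h3 : ∫ x in (0 : ℝ)..t, x * deriv (deriv ψ) x = (t * deriv ψ t - ψ t) - (0 * deriv ψ 0 - ψ 0) := by
    refine intervalIntegral.integral_eq_sub_of_hasDerivAt (f := fun x => x * deriv ψ x - ψ x)
      (fun x _ => ?_) (Continuous.intervalIntegrable (by fun_prop) _ _)
    exact (((hasDerivAt_id' x).fun_mul (hd' x)).fun_sub (hd x)).congr_deriv (by ring)
  have h4 : ∫ x in (t : ℝ)..1, (1 - x) * deriv (deriv ψ) x =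
      ((1 - 1) * deriv ψ 1 + ψ 1) - ((1 - t) * deriv ψ t + ψ t) := by
    refine intervalIntegral.integral_eq_sub_of_hasDerivAt (f := fun x => (1 - x) * deriv ψ x + ψ x)
      (fun x _ => ?_) (Continuous.intervalIntegrable (by fun_prop) _ _)
    exact ((((hasDerivAt_id' x).const_sub 1).fun_mul (hd' x)).fun_add (hd x)).congr_deriv (by ring)
  rw [h1, h2, intervalIntegral.integral_const_mul, intervalIntegral.integral_const_mul, h3, h4, ← h01]
  ring

theorem integral_deriv_deriv {ψ : ℝ → ℝ} (hψ : ContDiff ℝ 2 ψ) (h : deriv ψ 0 = deriv ψ 1) :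
    ∫ x : unitInterval, deriv (deriv ψ) x = 0 := by
  obtain ⟨hd, hd', hc⟩ := hasDerivAt_deriv_of_contDiff_two hψ
  rw [integral_unitInterval, intervalIntegral.integral_eq_sub_of_hasDerivAt (fun x _ => hd' x)
    (hc.intervalIntegrable _ _), h, sub_self]

theorem integral_deriv_deriv_mul_self {ψ : ℝ → ℝ} (hψ : ContDiff ℝ 2 ψ) (h01 : ψ 0 = ψ 1)
    (h : deriv ψ 0 = deriv ψ 1) :
    ∫ x : unitInterval, deriv (deriv ψ) x * ψ x = -∫ x : unitInterval, |deriv ψ x| ^ 2 := by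
  obtain ⟨hd, hd', hc⟩ := hasDerivAt_deriv_of_contDiff_two hψ
  have hcψ : Continuous ψ := hψ.continuous
  have hcψ' : Continuous (deriv ψ) := hψ.continuous_deriv (by norm_num)
  simp_rw [sq_abs]
  rw [integral_unitInterval fun x => deriv (deriv ψ) x * ψ x,
    integral_unitInterval fun x => deriv ψ x ^ 2, eq_neg_iff_add_eq_zero,
    ← intervalIntegral.integral_add (Continuous.intervalIntegrable (by fun_prop) _ _)
      (Continuous.intervalIntegrable (by fun_prop) _ _)]
  rw [intervalIntegral.integral_eq_sub_of_hasDerivAt (f := fun x => deriv ψ x * ψ x)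
      (fun x _ => ?_) (Continuous.intervalIntegrable (by fun_prop) _ _), h01, h, sub_self]
  exact ((hd' x).fun_mul (hd x)).congr_deriv (by ring)

variable {B : Measure Path}

theorem IsBrownianBridgeLaw.integral_eq_zero (hB : IsBrownianBridgeLaw B) : ∫ p, p ∂B = 0 := by
  have := hB.isGaussian
  ext t
  have h := (ContinuousMap.evalCLM ℝ t).integral_comp_comm (IsGaussian.integrable_fun_id (μ := B))
  have h0 := hB.mean_eq_zero t
  simpa [h0] using h.symm

theorem IsBrownianBridgeLaw.covVec_eval (hB : IsBrownianBridgeLaw B) (s t : unitInterval) :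
    covVec B (ContinuousMap.evalCLM ℝ t) s = min (s : ℝ) (t : ℝ) - (s : ℝ) * (t : ℝ) := by
  have := hB.isGaussian
  have h1 : covVec B (ContinuousMap.evalCLM ℝ t) s =
      ContinuousMap.evalCLM ℝ s (covVec B (ContinuousMap.evalCLM ℝ t)) := rfl
  have hL : ∀ r : unitInterval, MemLp (fun p : Path => p r) 2 B := fun r =>
    IsGaussian.memLp_dual B (ContinuousMap.evalCLM ℝ r) 2 (by simp)
  rw [h1, apply_covVec, ← hB.covariance_eq s t, covariance_eq_sub (hL s) (hL t),
    hB.mean_eq_zero, zero_mul, sub_zero]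
  simp [mul_comm]

theorem IsBrownianBridgeLaw.covVec_pairing (hB : IsBrownianBridgeLaw B) {ψ : ℝ → ℝ}
    (hψ : ContDiff ℝ 2 ψ) (hψ'' : Continuous (deriv (deriv ψ))) (h01 : ψ 0 = ψ 1) :
    covVec B (pairingCLM (restrictPath (deriv (deriv ψ)) hψ'')) =
      ContinuousMap.const _ (ψ 0) - restrictPath ψ hψ.continuous := by
  have := hB.isGaussian
  ext t
  have h1 : ∀ p : Path, p t = ContinuousMap.evalCLM ℝ t p := fun p => rfl
  rw [h1, apply_covVec_comm, pairingCLM_apply]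
  simp_rw [hB.covVec_eval]
  exact integral_deriv_deriv_mul_green hψ h01 t

end CircularBM

end

/-! ### The conditioned measure and its quasi-invariance -/

open CircularBM GaussianMeasure in
theorem lemma8p4 (B : Measure CircularBM.Path) (hB : CircularBM.IsBrownianBridgeLaw B)
    (φ : C(unitInterval, ℝ)) (hφ : ∫ x : unitInterval, φ x = 0) :
    (∃! E : Measure CircularBM.Path,
      CircularBM.IsConditionedAtZero (CircularBM.cbm B) CircularBM.mean (CircularBM.pairing φ) E) ∧
    ∀ E : Measure CircularBM.Path,
      CircularBM.IsConditionedAtZero (CircularBM.cbm B) CircularBM.mean (CircularBM.pairing φ) E →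
      ∀ (ψ : ℝ → ℝ) (hψ : ContDiff ℝ 2 ψ), ψ 0 = ψ 1 → deriv ψ 0 = deriv ψ 1 →
        ∫ x : unitInterval, ψ x = 0 → ∫ x : unitInterval, φ x * ψ x = 0 →
      ∀ F : CircularBM.Path → ℝ, Measurable F → (∃ C : ℝ, ∀ p, |F p| ≤ C) →
        Integrable (fun p : CircularBM.Path =>
          F (p + CircularBM.restrictPath ψ hψ.continuous) *
            Real.exp ((∫ x : unitInterval, deriv (deriv ψ) x * p x)
              - 1 / 2 * ∫ x : unitInterval, |deriv ψ x| ^ 2)) E ∧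
        ∫ p, F p ∂E =
          ∫ p, F (p + CircularBM.restrictPath ψ hψ.continuous) *
            Real.exp ((∫ x : unitInterval, deriv (deriv ψ) x * p x)
              - 1 / 2 * ∫ x : unitInterval, |deriv ψ x| ^ 2) ∂E := by
  have hBg := hB.isGaussian
  have hB0 := hB.integral_eq_zero
  set μ := B.map centre with hμ
  have hμ0 : ∫ p, p ∂μ = 0 := integral_map_eq_zero B hB0 centre
  have hmean : ∀ᵐ p ∂μ, mean p = 0 := by
    rw [hμ, ae_map_iff centre.continuous.aemeasurable
      (measurableSet_eq_fun continuous_mean.measurable measurable_const)]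
    exact Eventually.of_forall mean_centre
  set ν := μ.map (residual μ (pairingCLM φ)) with hν
  have hcond : IsConditionedAtZero (cbm B) mean (pairing φ) ν := by
    have := isConditionedAtZero_residual μ hμ0 hmean φ hφ
      (ENNReal.ofReal (1 / Real.sqrt (2 * Real.pi))) (by
        have : 0 < 1 / Real.sqrt (2 * Real.pi) := by positivity
        simpa using this) ENNReal.ofReal_ne_top
    rwa [hμ, ← map_add_const_eq] at this
  refine ⟨⟨ν, hcond, fun E hE => hE.unique hcond⟩, ?_⟩
  intro E hE ψ hψ h01 h01' hψ0 hφψ F hF ⟨C, hC⟩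
  rw [hE.unique hcond]
  have hc := (hasDerivAt_deriv_of_contDiff_two hψ).2.2
  set q := restrictPath ψ hψ.continuous with hq
  set ℓ := pairingCLM (restrictPath (deriv (deriv ψ)) hc) with hℓ
  have hmq : mean q = 0 := hψ0
  -- `ℓ` kills constants because `ψ'(0) = ψ'(1)` gives `∫ ψ'' = 0`.
  have hℓcentre : ℓ ∘L centre = ℓ := by
    ext p
    rw [ContinuousLinearMap.comp_apply, centre_apply, map_sub, hℓ,
      pairingCLM_const _ (integral_deriv_deriv hψ h01'), sub_zero]
  have hcov1 : covVec μ ℓ = -q := by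
    rw [hμ, covVec_map, hℓcentre, hℓ, hB.covVec_pairing hψ hc h01, centre_apply]
    have : mean (ContinuousMap.const unitInterval (ψ 0) - q) = ψ 0 := by
      rw [mean_eq_pairingCLM, map_sub, ← mean_eq_pairingCLM, ← mean_eq_pairingCLM, hmq]
      simp [mean]
    rw [this]
    simp [hq]
  have hcov : covVec ν ℓ = -q := by
    rw [hν, covVec_map_residual, hcov1, map_neg, residual_apply]
    have : pairingCLM φ q = 0 := hφψ
    simp [this]
  have hvar : ℓ (covVec ν ℓ) = ∫ x : unitInterval, |deriv ψ x| ^ 2 := by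
    rw [hcov, map_neg, neg_eq_iff_eq_neg]
    exact integral_deriv_deriv_mul_self hψ h01 h01'
  have hν0 : ∫ p, p ∂ν = 0 := integral_map_eq_zero μ hμ0 _
  -- Taking `F (· + q)` as test function makes the Cameron–Martin shift by `-q` restore `F` itself.
  have key := cameronMartin ν hν0 ℓ (G := fun p => F (p + q)) (hF.comp (measurable_id.add_const q))
    fun p => hC _
  have hexp : ∀ p : Path, ℓ p - ℓ (covVec ν ℓ) / 2 =
      (∫ x : unitInterval, deriv (deriv ψ) x * p x)
        - 1 / 2 * ∫ x : unitInterval, |deriv ψ x| ^ 2 := fun p => by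
    rw [hvar, div_eq_inv_mul, one_div]
    rfl
  simp only [hexp] at key
  simp only [hcov, neg_add_cancel_right] at key
  exact ⟨key.1, key.2.symm⟩
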